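/- Let $\ell,G>0$. Let the fields $L=(L_+(x^+),L_-(x^-))$ and the field-independent parameters $\epsilon=(\epsilon_+(x^+),\epsilon_-(x^-))$ be pairs of smooth $2\pi$-periodic functions of one real variable (real-valued or, more generally, complex-valued). On the region $r>0$, $r^4\neq \ell^4L_+(x^+)L_-(x^-)$ consider the Bañados metric $$g(L)=\ell^2\frac{dr^2}{r^2}-\Big(r\,dx^+-\frac{\ell^2L_-\,dx^-}{r}\Big)\Big(r\,dx^--\frac{\ell^2L_+\,dx^+}{r}\Big)$$ and the field-dependent vector field $$\chi(\epsilon;L)=-\frac r2(\epsilon_+'+\epsilon_-')\partial_r+\Big(\epsilon_++\frac{\ell^2r^2\epsilon_-''+\ell^4L_-\epsilon_+''}{2(r^4-\ell^4L_+L_-)}\Big)\partial_++\Big(\epsilon_-+\frac{\ell^2r^2\epsilon_+''+\ell^4L_+\epsilon_-''}{2(r^4-\ell^4L_+L_-)}\Big)\partial_- .$$ Put $\delta_\epsilon L=(\delta_{\epsilon_+}L_+,\delta_{\epsilon_-}L_-)$ with $\delta_{\epsilon_\pm}L_\pm=\epsilon_\pm L_\pm'+2L_\pm\epsilon_\pm'-\tfrac12\epsilon_\pm'''$,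 and for a function $F$ of the fields let $\delta_\epsilon F(L)=\frac{d}{ds}\big|_{s=0}F(L+s\,\delta_\epsilon L)$. The adjusted bracket is $$[\chi(\epsilon_1;L),\chi(\epsilon_2;L)]_*=[\chi(\epsilon_1;L),\chi(\epsilon_2;L)]-\big(\delta_{\epsilon_1}\chi(\epsilon_2;L)-\delta_{\epsilon_2}\chi(\epsilon_1;L)\big),$$ where the first term is the Lie bracket of vector fields and the variations act on $L$ only. Then: 1. $\mathcal L_{\chi(\epsilon;L)}\,g(L)=\delta_\epsilon g(L)$, i.e. $\delta_\epsilon L$ is the variation of the fields induced by the diffeomorphism along $\chi(\epsilon;L)$. 2. $[\chi(\epsilon_1;L),\chi(\epsilon_2;L)]_*=\chi(\epsilon_1\epsilon_2'-\epsilon_1'\epsilon_2;L)$, the parameter on the right being formed separately in the $+$ and the $-$ sector. 3. For $m,n\in\mathbb Z$ the modes $\chi^+_n=\chi(\epsilon_+=e^{inx^+},\epsilon_-=0;L)$ and $\chi^-_n=\chi(\epsilon_+=0,\epsilon_-=e^{inx^-};L)$ form two commuting Witt algebras: $$i[\chi^\pm_m,\chi^\pm_n]_*=(m-n)\chi^\pm_{m+n},\qquad[\chi^+_m,\chi^-_n]_*=0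 .$$ 4. Let $Q_\epsilon(L)=\frac{\ell}{8\pi G}\int_0^{2\pi}d\phi\,\big(\epsilon_+(x^+)L_+(x^+)+\epsilon_-(x^-)L_-(x^-)\big)$ with $x^\pm=t/\ell\pm\phi$ at any fixed time $t$, with the bracket $\{Q_{\epsilon_1},Q_{\epsilon_2}\}=-\delta_{\epsilon_1}Q_{\epsilon_2}$, and let $L_n$, $\bar L_n$ denote the charges of $\chi^+_n$, $\chi^-_n$. Then for $m,n\in\mathbb Z$ $$i\{L_m,L_n\}=(m-n)L_{m+n}+\frac c{12}m^3\delta_{m+n,0},\qquad\{\bar L_m,L_n\}=0,\qquad i\{\bar L_m,\bar L_n\}=(m-n)\bar L_{m+n}+\frac c{12}m^3\delta_{m+n,0},$$ two commuting Virasoro algebras with the Brown–Henneaux central charge $c=\frac{3\ell}{2G}$. -/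

import Mathlib

open scoped ContDiff

noncomputable section

namespace AdS3

/-- A pair `f = (f₊, f₋)` of functions of one variable; `f₊` is evaluated at the light-cone
coordinate `x⁺` and `f₋` at `x⁻`.  Both the fields `L = (L₊, L₋)` and the symmetry parameters
`ε = (ε₊, ε₋)` are of this kind.  Values are complex so that Fourier modes are allowed. -/
abbrev ChiralPair : Type := (ℝ → ℂ) × (ℝ → ℂ)

/-- Smooth and `2π`-periodic, i.e. single valued under `(x⁺, x⁻) ∼ (x⁺ + 2π, x⁻ - 2π)`. -/
def Admissible (f : ChiralPair) : Prop :=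
  (ContDiff ℝ ∞ f.1 ∧ Function.Periodic f.1 (2 * Real.pi)) ∧
    (ContDiff ℝ ∞ f.2 ∧ Function.Periodic f.2 (2 * Real.pi))

/-- Coordinates `x 0 = r`, `x 1 = x⁺`, `x 2 = x⁻`. -/
abbrev Coord : Type := Fin 3 → ℝ

/-- Components `(V^r, V^+, V^-)` of a complexified vector field. -/
abbrev VField : Type := Coord → Fin 3 → ℂ

/-- The partial derivative `∂f/∂x^ν`. -/
def pderiv (ν : Fin 3) (f : Coord → ℂ) (x : Coord) : ℂ :=
  fderiv ℝ f x (Pi.single ν 1)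

/-- The Lie bracket `[V, W]^μ = V^ν ∂_ν W^μ - W^ν ∂_ν V^μ`. -/
def lieBracket (V W : VField) : VField := fun x μ =>
  ∑ ν, (V x ν * pderiv ν (fun y => W y μ) x - W x ν * pderiv ν (fun y => V y μ) x)

/-- The Lie derivative of a covariant 2-tensor,
`(ℒ_V g)_{μν} = V^ρ ∂_ρ g_{μν} + g_{ρν} ∂_μ V^ρ + g_{μρ} ∂_ν V^ρ`. -/
def lieDerivTensor (V : VField) (g : Coord → Fin 3 → Fin 3 → ℂ) : Coord → Fin 3 → Fin 3 → ℂ :=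
  fun x μ ν => ∑ ρ, (V x ρ * pderiv ρ (fun y => g y μ ν) x
    + g x ρ ν * pderiv μ (fun y => V y ρ) x + g x μ ρ * pderiv ν (fun y => V y ρ) x)

/-- The Bañados metric
`ds² = ℓ² dr²/r² - (r dx⁺ - ℓ² L₋ dx⁻/r) (r dx⁻ - ℓ² L₊ dx⁺/r)` in components. -/
def banadosMetric (ℓ : ℝ) (L : ChiralPair) : Coord → Fin 3 → Fin 3 → ℂ := fun x =>
  let r : ℂ := (x 0 : ℂ)
  let Lp : ℂ := L.1 (x 1)
  let Lm : ℂ := L.2 (x 2)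
  let gpm : ℂ := -(r ^ 2 + (ℓ : ℂ) ^ 4 * Lp * Lm / r ^ 2) / 2
  ![![(ℓ : ℂ) ^ 2 / r ^ 2, 0, 0],
    ![0, (ℓ : ℂ) ^ 2 * Lp, gpm],
    ![0, gpm, (ℓ : ℂ) ^ 2 * Lm]]

/-- The region `r > 0`, `r⁴ ≠ ℓ⁴ L₊(x⁺) L₋(x⁻)` where the Bañados metric is nondegenerate. -/
def patch (ℓ : ℝ) (L : ChiralPair) : Set Coord :=
  {x | 0 < x 0 ∧ (x 0 : ℂ) ^ 4 ≠ (ℓ : ℂ) ^ 4 * L.1 (x 1) * L.2 (x 2)}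

/-- The field-dependent symplectic symmetry vector `χ(ε; L)`. -/
def chi (ℓ : ℝ) (ε L : ChiralPair) : VField := fun x =>
  let r : ℂ := (x 0 : ℂ)
  let Lp : ℂ := L.1 (x 1)
  let Lm : ℂ := L.2 (x 2)
  let ep'' : ℂ := iteratedDeriv 2 ε.1 (x 1)
  let em'' : ℂ := iteratedDeriv 2 ε.2 (x 2)
  let D : ℂ := 2 * (r ^ 4 - (ℓ : ℂ) ^ 4 * Lp * Lm)
  ![-(r / 2) * (deriv ε.1 (x 1) + deriv ε.2 (x 2)),
    ε.1 (x 1) + ((ℓ : ℂ) ^ 2 * r ^ 2 * em'' + (ℓ : ℂ) ^ 4 * Lm * ep'') / D,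
    ε.2 (x 2) + ((ℓ : ℂ) ^ 2 * r ^ 2 * ep'' + (ℓ : ℂ) ^ 4 * Lp * em'') / D]

/-- One chiral half of the transformation law: `ε L' + 2 L ε' - ε'''/2`. -/
def chiralVar (ε L : ℝ → ℂ) : ℝ → ℂ := fun u =>
  ε u * deriv L u + 2 * L u * deriv ε u - iteratedDeriv 3 ε u / 2

/-- The variation `δ_ε L = (δ_{ε₊} L₊, δ_{ε₋} L₋)`, a tangent vector at the field `L`. -/
def fieldVar (ε L : ChiralPair) : ChiralPair := (chiralVar ε.1 L.1, chiralVar ε.2 L.2)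

/-- The directional derivative `δ_ε F` at `L` of a function `F` of the fields, along `δ_ε L`. -/
def variation (ε : ChiralPair) (F : ChiralPair → ℂ) (L : ChiralPair) : ℂ :=
  deriv (fun s : ℝ => F (L + s • fieldVar ε L)) 0

/-- `δ^L_{ε₁} χ(ε₂; L) = δ_{ε₁} L ∂/∂L χ(ε₂; L)`, with `ε₂` held fixed. -/
def chiVar (ℓ : ℝ) (ε₁ ε₂ L : ChiralPair) : VField := fun x μ =>
  variation ε₁ (fun L' => chi ℓ ε₂ L' x μ) L

/-- The adjusted bracket `[χ(ε₁; L), χ(ε₂; L)]_*`. -/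
def adjustedBracket (ℓ : ℝ) (ε₁ ε₂ L : ChiralPair) : VField :=
  lieBracket (chi ℓ ε₁ L) (chi ℓ ε₂ L) - (chiVar ℓ ε₁ ε₂ L - chiVar ℓ ε₂ ε₁ L)

/-- `ε₁ ε₂' - ε₁' ε₂`, in each chiral sector. -/
def paramBracket (ε₁ ε₂ : ChiralPair) : ChiralPair :=
  (fun u => ε₁.1 u * deriv ε₂.1 u - deriv ε₁.1 u * ε₂.1 u,
   fun u => ε₁.2 u * deriv ε₂.2 u - deriv ε₁.2 u * ε₂.2 u)

/-- The charge `Q = (ℓ/8πG) ∮ dφ (ε₊ L₊ + ε₋ L₋)` on the circle at time `t`,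
with `x^± = t/ℓ ± φ`. -/
def charge (ℓ G t : ℝ) (ε L : ChiralPair) : ℂ :=
  ((ℓ / (8 * Real.pi * G) : ℝ) : ℂ) * ∫ φ in (0 : ℝ)..(2 * Real.pi),
    (ε.1 (t / ℓ + φ) * L.1 (t / ℓ + φ) + ε.2 (t / ℓ - φ) * L.2 (t / ℓ - φ))

/-- The bracket of charges `{Q_{χ₁}, Q_{χ₂}} = - δ_{χ₁} Q_{χ₂}`. -/
def chargeBracket (ℓ G t : ℝ) (ε₁ ε₂ L : ChiralPair) : ℂ :=
  - variation ε₁ (charge ℓ G t ε₂) L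

/-- The Fourier mode `u ↦ e^{i n u}`. -/
def expMode (n : ℤ) : ℝ → ℂ := fun u => Complex.exp (Complex.I * n * u)

/-- Parameter of `χ⁺_n`: `ε₊ = e^{i n x⁺}`, `ε₋ = 0`. -/
def plusMode (n : ℤ) : ChiralPair := (expMode n, 0)

/-- Parameter of `χ⁻_n`: `ε₊ = 0`, `ε₋ = e^{i n x⁻}`. -/
def minusMode (n : ℤ) : ChiralPair := (0, expMode n)

/-- The Brown–Henneaux central charge `c = 3ℓ/2G`. -/
def centralCharge (ℓ G : ℝ) : ℝ := 3 * ℓ / (2 * G)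

end AdS3

end

/-!
Everything in the first three claims is local: at a point `x` of the patch, each side is a rational
function of `r`, of `ℓ`, and of the values at `x^±` of `L_±`, `ε_±` and their derivatives, whose
only denominators are powers of `r` and of `E = r⁴ - ℓ⁴ L₊ L₋`, both nonzero there. So it suffices
to know the first partial derivatives of `χ` and of the metric (`hasGrad_chi_r`, `hasGrad_chi_plus`,
`hasGrad_chi_minus`, `hasGrad_banadosMetric`) and their variations along `δ_ε L` (`chiVar_plus`,
`chiVar_minus`, `metricVar`). The Killing-type equation (`lieDerivTensor_banadosMetric`) and the
closure of the adjusted bracket (`adjustedBracket_eq_chi`) are then polynomial identities. Only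
derivatives of `ε` up to the third order occur in the closure: those of third order produced by the
Lie bracket either combine into `(ε₁ ε₂' - ε₁' ε₂)''` (`iteratedDeriv_two_wronskian`) or cancel
against the `-ε'''/2` in `δ_ε L`. That cancellation is the reason for adjusting the bracket.

The Witt algebras follow by linearity of `χ` in `ε`, since for Fourier modes `ε₁ ε₂' - ε₁' ε₂` is
`i (n - m) e^{i(m+n)u}` (`expMode_wronskian`).

The charge is linear in `L`, so `{Q_{ε₁}, Q_{ε₂}}` is minus the charge of `ε₂` at the field
`δ_{ε₁} L` (`chargeBracket_eq`). By periodicity neither the time nor the orientation of the circle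
matters (`charge_eq`). Integrating `e^{inu} δ_{e^{imu}} L` by parts over a period
(`integral_expMode_mul_chiralVar`) gives `i (m - n) ∮ e^{i(m+n)u} L`, while the `L`-independent term
`-ε'''/2` contributes `i m³/2 ∮ e^{i(m+n)u}`, the central extension.
-/

noncomputable section

namespace AdS3

/-! ### Calculus of partial derivatives in the coordinates `(r, x⁺, x⁻)` -/

/-- `f` is differentiable at `x`, with partial derivatives `d ν = ∂f/∂x^ν`. -/
def HasGrad (f : Coord → ℂ) (d : Fin 3 → ℂ) (x : Coord) : Prop :=
  ∃ f' : Coord →L[ℝ] ℂ, HasFDerivAt f f' x ∧ ∀ ν, f' (Pi.single ν 1) = d ν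

namespace HasGrad

variable {f g : Coord → ℂ} {d e : Fin 3 → ℂ} {x : Coord}

theorem pderiv_eq (h : HasGrad f d x) (ν : Fin 3) : pderiv ν f x = d ν := by
  obtain ⟨f', hf, hd⟩ := h
  rw [pderiv, hf.fderiv, hd]

theorem of_eq (h : HasGrad f d x) (hde : ∀ ν, d ν = e ν) : HasGrad f e x :=
  funext hde ▸ h

theorem const (c : ℂ) (x : Coord) : HasGrad (fun _ => c) 0 x :=
  ⟨0, hasFDerivAt_const c x, fun _ => rfl⟩

theorem comp_coord {u : ℝ → ℂ} {u' : ℂ} (i : Fin 3) (h : HasDerivAt u u' (x i)) :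
    HasGrad (fun y => u (y i)) (Pi.single i u') x := by
  refine ⟨_, h.hasFDerivAt.comp x (hasFDerivAt_apply i x), fun ν => ?_⟩
  by_cases hν : ν = i
  · subst hν; simp
  · simp [Pi.single_eq_of_ne hν, Pi.single_eq_of_ne (Ne.symm hν)]

theorem add (hf : HasGrad f d x) (hg : HasGrad g e x) :
    HasGrad (fun y => f y + g y) (fun ν => d ν + e ν) x := by
  obtain ⟨f', hf, hd⟩ := hf
  obtain ⟨g', hg, he⟩ := hg
  exact ⟨_, hf.add hg, fun ν => by simp [hd, he]⟩

theorem mul (hf : HasGrad f d x) (hg : HasGrad g e x) :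
    HasGrad (fun y => f y * g y) (fun ν => f x * e ν + d ν * g x) x := by
  obtain ⟨f', hf, hd⟩ := hf
  obtain ⟨g', hg, he⟩ := hg
  exact ⟨_, hf.mul hg, fun ν => by simp [hd, he, mul_comm]⟩

theorem inv (hf : HasGrad f d x) (h0 : f x ≠ 0) :
    HasGrad (fun y => (f y)⁻¹) (fun ν => -d ν / f x ^ 2) x := by
  obtain ⟨f', hf, hd⟩ := hf
  refine ⟨_, (hasFDerivAt_inv' (𝕜 := ℝ) h0).comp x hf, fun ν => ?_⟩
  simp [hd]
  field_simp

theorem div (hf : HasGrad f d x) (hg : HasGrad g e x) (h0 : g x ≠ 0) :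
    HasGrad (fun y => f y / g y) (fun ν => (d ν * g x - f x * e ν) / g x ^ 2) x := by
  simp only [div_eq_mul_inv (f _)]
  refine (hf.mul (hg.inv h0)).of_eq fun ν => ?_
  field_simp
  ring

theorem neg (hf : HasGrad f d x) : HasGrad (fun y => -f y) (fun ν => -d ν) x := by
  obtain ⟨f', hf, hd⟩ := hf
  exact ⟨_, hf.neg, fun ν => by simp [hd]⟩

theorem sub (hf : HasGrad f d x) (hg : HasGrad g e x) :
    HasGrad (fun y => f y - g y) (fun ν => d ν - e ν) x := by
  simpa only [sub_eq_add_neg] using hf.add hg.neg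

theorem pow (hf : HasGrad f d x) (n : ℕ) :
    HasGrad (fun y => f y ^ n) (fun ν => n * f x ^ (n - 1) * d ν) x := by
  obtain ⟨f', hf, hd⟩ := hf
  exact ⟨_, hf.pow n, fun ν => by simp [hd]⟩

end HasGrad

/-! ### Partial derivatives of the symmetry vector and of the metric -/

theorem hasGrad_radius (x : Coord) : HasGrad (fun y => (y 0 : ℂ)) ![1, 0, 0] x := by
  refine (HasGrad.comp_coord (u := fun s : ℝ => (s : ℂ)) 0
    (Complex.ofRealCLM.hasDerivAt (x := x 0))).of_eq fun ν => ?_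
  fin_cases ν <;> simp

theorem hasGrad_plus {u : ℝ → ℂ} (hu : Differentiable ℝ u) (x : Coord) :
    HasGrad (fun y => u (y 1)) ![0, deriv u (x 1), 0] x := by
  refine (HasGrad.comp_coord 1 (hu (x 1)).hasDerivAt).of_eq fun ν => ?_
  fin_cases ν <;> simp

theorem hasGrad_minus {u : ℝ → ℂ} (hu : Differentiable ℝ u) (x : Coord) :
    HasGrad (fun y => u (y 2)) ![0, 0, deriv u (x 2)] x := by
  refine (HasGrad.comp_coord 2 (hu (x 2)).hasDerivAt).of_eq fun ν => ?_
  fin_cases ν <;> simp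

theorem hasGrad_iteratedDeriv_plus {u : ℝ → ℂ} (hu : ContDiff ℝ ∞ u) (n : ℕ) (x : Coord) :
    HasGrad (fun y => iteratedDeriv n u (y 1)) ![0, iteratedDeriv (n + 1) u (x 1), 0] x := by
  rw [iteratedDeriv_succ]
  exact hasGrad_plus (hu.differentiable_iteratedDeriv n (by exact_mod_cast WithTop.coe_lt_top _)) x

theorem hasGrad_iteratedDeriv_minus {u : ℝ → ℂ} (hu : ContDiff ℝ ∞ u) (n : ℕ) (x : Coord) :
    HasGrad (fun y => iteratedDeriv n u (y 2)) ![0, 0, iteratedDeriv (n + 1) u (x 2)] x := by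
  rw [iteratedDeriv_succ]
  exact hasGrad_minus (hu.differentiable_iteratedDeriv n (by exact_mod_cast WithTop.coe_lt_top _)) x

section Gradients

variable {ℓ : ℝ} {ε L : ChiralPair} {x : Coord}

theorem hasGrad_chi_r (hε : Admissible ε) (x : Coord) :
    HasGrad (fun y => chi ℓ ε L y 0)
      ![-(deriv ε.1 (x 1) + deriv ε.2 (x 2)) / 2,
        -(x 0 / 2) * iteratedDeriv 2 ε.1 (x 1),
        -(x 0 / 2) * iteratedDeriv 2 ε.2 (x 2)] x := by
  have hp := hasGrad_iteratedDeriv_plus hε.1.1 1 x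
  have hm := hasGrad_iteratedDeriv_minus hε.2.1 1 x
  simp only [iteratedDeriv_one] at hp hm
  refine (((hasGrad_radius x).div (.const 2 x) two_ne_zero).neg.mul (hp.add hm)).of_eq fun ν => ?_
  fin_cases ν <;> simp <;> ring

/-- Gradient of `χ^+ = ε₊ + N/(2E)`, by the quotient rule. -/
theorem hasGrad_chi_plus (hε : Admissible ε) (hL : Admissible L)
    (hD : (x 0 : ℂ) ^ 4 - (ℓ : ℂ) ^ 4 * L.1 (x 1) * L.2 (x 2) ≠ 0) :
    HasGrad (fun y => chi ℓ ε L y 1)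
      (let r : ℂ := x 0
       let E : ℂ := r ^ 4 - (ℓ : ℂ) ^ 4 * L.1 (x 1) * L.2 (x 2)
       let N : ℂ := (ℓ : ℂ) ^ 2 * r ^ 2 * iteratedDeriv 2 ε.2 (x 2)
          + (ℓ : ℂ) ^ 4 * L.2 (x 2) * iteratedDeriv 2 ε.1 (x 1)
       ![((ℓ : ℂ) ^ 2 * r * iteratedDeriv 2 ε.2 (x 2) * E - 2 * r ^ 3 * N) / E ^ 2,
         deriv ε.1 (x 1) + ((ℓ : ℂ) ^ 4 * L.2 (x 2) * iteratedDeriv 3 ε.1 (x 1) * E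
            + (ℓ : ℂ) ^ 4 * deriv L.1 (x 1) * L.2 (x 2) * N) / (2 * E ^ 2),
         (((ℓ : ℂ) ^ 2 * r ^ 2 * iteratedDeriv 3 ε.2 (x 2)
            + (ℓ : ℂ) ^ 4 * deriv L.2 (x 2) * iteratedDeriv 2 ε.1 (x 1)) * E
            + (ℓ : ℂ) ^ 4 * L.1 (x 1) * deriv L.2 (x 2) * N) / (2 * E ^ 2)]) x := by
  have hp := hasGrad_plus (hε.1.1.differentiable (by simp)) x
  have hp2 := hasGrad_iteratedDeriv_plus hε.1.1 2 x
  have hm2 := hasGrad_iteratedDeriv_minus hε.2.1 2 x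
  have ha := hasGrad_plus (hL.1.1.differentiable (by simp)) x
  have hb := hasGrad_minus (hL.2.1.differentiable (by simp)) x
  have hr := hasGrad_radius x
  have hk := fun n : ℕ => HasGrad.const ((ℓ : ℂ) ^ n) x
  refine (hp.add (((((hk 2).mul (hr.pow 2)).mul hm2).add (((hk 4).mul hb).mul hp2)).div
    ((HasGrad.const 2 x).mul ((hr.pow 4).sub (((hk 4).mul ha).mul hb)))
      (mul_ne_zero two_ne_zero hD))).of_eq fun ν => ?_
  fin_cases ν <;> simp <;> field_simp <;> ring

/-- Gradient of `χ^- = ε₋ + N/(2E)`; the formula is that of `hasGrad_chi_plus` with the two chiral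
sectors exchanged. -/
theorem hasGrad_chi_minus (hε : Admissible ε) (hL : Admissible L)
    (hD : (x 0 : ℂ) ^ 4 - (ℓ : ℂ) ^ 4 * L.1 (x 1) * L.2 (x 2) ≠ 0) :
    HasGrad (fun y => chi ℓ ε L y 2)
      (let r : ℂ := x 0
       let E : ℂ := r ^ 4 - (ℓ : ℂ) ^ 4 * L.1 (x 1) * L.2 (x 2)
       let N : ℂ := (ℓ : ℂ) ^ 2 * r ^ 2 * iteratedDeriv 2 ε.1 (x 1)
          + (ℓ : ℂ) ^ 4 * L.1 (x 1) * iteratedDeriv 2 ε.2 (x 2)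
       ![((ℓ : ℂ) ^ 2 * r * iteratedDeriv 2 ε.1 (x 1) * E - 2 * r ^ 3 * N) / E ^ 2,
         (((ℓ : ℂ) ^ 2 * r ^ 2 * iteratedDeriv 3 ε.1 (x 1)
            + (ℓ : ℂ) ^ 4 * deriv L.1 (x 1) * iteratedDeriv 2 ε.2 (x 2)) * E
            + (ℓ : ℂ) ^ 4 * deriv L.1 (x 1) * L.2 (x 2) * N) / (2 * E ^ 2),
         deriv ε.2 (x 2) + ((ℓ : ℂ) ^ 4 * L.1 (x 1) * iteratedDeriv 3 ε.2 (x 2) * E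
            + (ℓ : ℂ) ^ 4 * L.1 (x 1) * deriv L.2 (x 2) * N) / (2 * E ^ 2)]) x := by
  have hm := hasGrad_minus (hε.2.1.differentiable (by simp)) x
  have hp2 := hasGrad_iteratedDeriv_plus hε.1.1 2 x
  have hm2 := hasGrad_iteratedDeriv_minus hε.2.1 2 x
  have ha := hasGrad_plus (hL.1.1.differentiable (by simp)) x
  have hb := hasGrad_minus (hL.2.1.differentiable (by simp)) x
  have hr := hasGrad_radius x
  have hk := fun n : ℕ => HasGrad.const ((ℓ : ℂ) ^ n) x
  refine (hm.add (((((hk 2).mul (hr.pow 2)).mul hp2).add (((hk 4).mul ha).mul hm2)).div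
    ((HasGrad.const 2 x).mul ((hr.pow 4).sub (((hk 4).mul ha).mul hb)))
      (mul_ne_zero two_ne_zero hD))).of_eq fun ν => ?_
  fin_cases ν <;> simp <;> field_simp <;> ring

/-- Gradient of `g_{+-}`. -/
theorem hasGrad_metric_offdiag (hL : Admissible L) (hr0 : (x 0 : ℂ) ≠ 0) :
    HasGrad (fun y => -((y 0 : ℂ) ^ 2 + (ℓ : ℂ) ^ 4 * L.1 (y 1) * L.2 (y 2) / (y 0 : ℂ) ^ 2) / 2)
      ![-(x 0 : ℂ) + (ℓ : ℂ) ^ 4 * L.1 (x 1) * L.2 (x 2) / (x 0 : ℂ) ^ 3,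
        -((ℓ : ℂ) ^ 4 * deriv L.1 (x 1) * L.2 (x 2)) / (2 * (x 0 : ℂ) ^ 2),
        -((ℓ : ℂ) ^ 4 * L.1 (x 1) * deriv L.2 (x 2)) / (2 * (x 0 : ℂ) ^ 2)] x := by
  have ha := hasGrad_plus (hL.1.1.differentiable (by simp)) x
  have hb := hasGrad_minus (hL.2.1.differentiable (by simp)) x
  have hr := hasGrad_radius x
  have hk := fun n : ℕ => HasGrad.const ((ℓ : ℂ) ^ n) x
  refine (((hr.pow 2).add ((((hk 4).mul ha).mul hb).div (hr.pow 2) (pow_ne_zero 2 hr0))).neg.div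
    (.const 2 x) two_ne_zero).of_eq fun ν => ?_
  fin_cases ν <;> simp <;> field_simp <;> ring

/-- The partial derivatives of the metric, `banadosMetricGrad ℓ L x μ ν ρ = ∂_ρ g_{μν}`. -/
def banadosMetricGrad (ℓ : ℝ) (L : ChiralPair) (x : Coord) : Fin 3 → Fin 3 → Fin 3 → ℂ :=
  let r : ℂ := (x 0 : ℂ)
  let h : Fin 3 → ℂ := ![-r + (ℓ : ℂ) ^ 4 * L.1 (x 1) * L.2 (x 2) / r ^ 3,
    -((ℓ : ℂ) ^ 4 * deriv L.1 (x 1) * L.2 (x 2)) / (2 * r ^ 2),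
    -((ℓ : ℂ) ^ 4 * L.1 (x 1) * deriv L.2 (x 2)) / (2 * r ^ 2)]
  ![![![-2 * (ℓ : ℂ) ^ 2 / r ^ 3, 0, 0], 0, 0],
    ![0, ![0, (ℓ : ℂ) ^ 2 * deriv L.1 (x 1), 0], h],
    ![0, h, ![0, 0, (ℓ : ℂ) ^ 2 * deriv L.2 (x 2)]]]

theorem hasGrad_banadosMetric (hL : Admissible L) (hr0 : (x 0 : ℂ) ≠ 0) (μ ν : Fin 3) :
    HasGrad (fun y => banadosMetric ℓ L y μ ν) (banadosMetricGrad ℓ L x μ ν) x := by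
  have ha := hasGrad_plus (hL.1.1.differentiable (by simp)) x
  have hb := hasGrad_minus (hL.2.1.differentiable (by simp)) x
  have hr := hasGrad_radius x
  have hk := HasGrad.const ((ℓ : ℂ) ^ 2) x
  have h0 := HasGrad.const 0 x
  have ho := hasGrad_metric_offdiag (ℓ := ℓ) hL hr0
  fin_cases μ <;> fin_cases ν
  · refine (hk.div (hr.pow 2) (pow_ne_zero 2 hr0)).of_eq fun ν => ?_
    fin_cases ν <;> simp [banadosMetricGrad]
    field_simp
  · exact h0
  · exact h0
  · exact h0
  · refine (hk.mul ha).of_eq fun ν => ?_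
    fin_cases ν <;> simp [banadosMetricGrad]
  · exact ho
  · exact h0
  · exact ho
  · refine (hk.mul hb).of_eq fun ν => ?_
    fin_cases ν <;> simp [banadosMetricGrad]

end Gradients

/-! ### Variations along the fields -/

theorem chi_zero (ℓ : ℝ) (ε L : ChiralPair) (x : Coord) :
    chi ℓ ε L x 0 = -((x 0 : ℂ) / 2) * (deriv ε.1 (x 1) + deriv ε.2 (x 2)) := rfl

theorem chi_one (ℓ : ℝ) (ε L : ChiralPair) (x : Coord) :
    chi ℓ ε L x 1 = ε.1 (x 1) + ((ℓ : ℂ) ^ 2 * (x 0 : ℂ) ^ 2 * iteratedDeriv 2 ε.2 (x 2)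
      + (ℓ : ℂ) ^ 4 * L.2 (x 2) * iteratedDeriv 2 ε.1 (x 1)) /
        (2 * ((x 0 : ℂ) ^ 4 - (ℓ : ℂ) ^ 4 * L.1 (x 1) * L.2 (x 2))) := rfl

theorem chi_two (ℓ : ℝ) (ε L : ChiralPair) (x : Coord) :
    chi ℓ ε L x 2 = ε.2 (x 2) + ((ℓ : ℂ) ^ 2 * (x 0 : ℂ) ^ 2 * iteratedDeriv 2 ε.1 (x 1)
      + (ℓ : ℂ) ^ 4 * L.1 (x 1) * iteratedDeriv 2 ε.2 (x 2)) /
        (2 * ((x 0 : ℂ) ^ 4 - (ℓ : ℂ) ^ 4 * L.1 (x 1) * L.2 (x 2))) := rfl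

theorem hasDerivAt_add_smul (a α : ℂ) : HasDerivAt (fun s : ℝ => a + s • α) α 0 := by
  simpa using ((hasDerivAt_id (0 : ℝ)).smul_const α).const_add a

section

variable {ℓ : ℝ} {x : Coord}

/-- The radial component of `χ` does not involve the fields. -/
theorem chiVar_r (ε₁ ε₂ L : ChiralPair) : chiVar ℓ ε₁ ε₂ L x 0 = 0 := by
  simp [chiVar, variation, chi_zero]

/-- The numerator and the denominator of the `L`-dependent part of `χ^+` are polynomial in the
values of the fields at the point, so the variation is a quotient rule in one variable. -/
theorem chiVar_plus (ε₁ ε₂ L : ChiralPair)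
    (hD : (x 0 : ℂ) ^ 4 - (ℓ : ℂ) ^ 4 * L.1 (x 1) * L.2 (x 2) ≠ 0) :
    chiVar ℓ ε₁ ε₂ L x 1 =
      (let α : ℂ := chiralVar ε₁.1 L.1 (x 1)
       let β : ℂ := chiralVar ε₁.2 L.2 (x 2)
       let E : ℂ := (x 0 : ℂ) ^ 4 - (ℓ : ℂ) ^ 4 * L.1 (x 1) * L.2 (x 2)
       let N : ℂ := (ℓ : ℂ) ^ 2 * (x 0 : ℂ) ^ 2 * iteratedDeriv 2 ε₂.2 (x 2)
          + (ℓ : ℂ) ^ 4 * L.2 (x 2) * iteratedDeriv 2 ε₂.1 (x 1)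
       ((ℓ : ℂ) ^ 4 * β * iteratedDeriv 2 ε₂.1 (x 1) * E
          + (ℓ : ℂ) ^ 4 * (α * L.2 (x 2) + L.1 (x 1) * β) * N) / (2 * E ^ 2)) := by
  have ha := hasDerivAt_add_smul (L.1 (x 1)) (chiralVar ε₁.1 L.1 (x 1))
  have hb := hasDerivAt_add_smul (L.2 (x 2)) (chiralVar ε₁.2 L.2 (x 2))
  refine (((((hb.const_mul ((ℓ : ℂ) ^ 4)).mul_const (iteratedDeriv 2 ε₂.1 (x 1))).const_add
    ((ℓ : ℂ) ^ 2 * (x 0 : ℂ) ^ 2 * iteratedDeriv 2 ε₂.2 (x 2))).fun_div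
    ((((ha.const_mul ((ℓ : ℂ) ^ 4)).fun_mul hb).const_sub ((x 0 : ℂ) ^ 4)).const_mul 2)
      (by simpa using hD)).const_add (ε₂.1 (x 1))).deriv.trans ?_
  simp only [zero_smul, add_zero]
  field_simp
  ring

theorem chiVar_minus (ε₁ ε₂ L : ChiralPair)
    (hD : (x 0 : ℂ) ^ 4 - (ℓ : ℂ) ^ 4 * L.1 (x 1) * L.2 (x 2) ≠ 0) :
    chiVar ℓ ε₁ ε₂ L x 2 =
      (let α : ℂ := chiralVar ε₁.1 L.1 (x 1)
       let β : ℂ := chiralVar ε₁.2 L.2 (x 2)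
       let E : ℂ := (x 0 : ℂ) ^ 4 - (ℓ : ℂ) ^ 4 * L.1 (x 1) * L.2 (x 2)
       let N : ℂ := (ℓ : ℂ) ^ 2 * (x 0 : ℂ) ^ 2 * iteratedDeriv 2 ε₂.1 (x 1)
          + (ℓ : ℂ) ^ 4 * L.1 (x 1) * iteratedDeriv 2 ε₂.2 (x 2)
       ((ℓ : ℂ) ^ 4 * α * iteratedDeriv 2 ε₂.2 (x 2) * E
          + (ℓ : ℂ) ^ 4 * (α * L.2 (x 2) + L.1 (x 1) * β) * N) / (2 * E ^ 2)) := by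
  have ha := hasDerivAt_add_smul (L.1 (x 1)) (chiralVar ε₁.1 L.1 (x 1))
  have hb := hasDerivAt_add_smul (L.2 (x 2)) (chiralVar ε₁.2 L.2 (x 2))
  refine (((((ha.const_mul ((ℓ : ℂ) ^ 4)).mul_const (iteratedDeriv 2 ε₂.2 (x 2))).const_add
    ((ℓ : ℂ) ^ 2 * (x 0 : ℂ) ^ 2 * iteratedDeriv 2 ε₂.1 (x 1))).fun_div
    ((((ha.const_mul ((ℓ : ℂ) ^ 4)).fun_mul hb).const_sub ((x 0 : ℂ) ^ 4)).const_mul 2)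
      (by simpa using hD)).const_add (ε₂.2 (x 2))).deriv.trans ?_
  simp only [zero_smul, add_zero]
  field_simp
  ring

/-- The metric depends on `L` only through its values at the point, without derivatives. -/
theorem metricVar (ε L : ChiralPair) (μ ν : Fin 3) :
    variation ε (fun L' => banadosMetric ℓ L' x μ ν) L =
      (let α : ℂ := chiralVar ε.1 L.1 (x 1)
       let β : ℂ := chiralVar ε.2 L.2 (x 2)
       let h : ℂ := -((ℓ : ℂ) ^ 4 * (α * L.2 (x 2) + L.1 (x 1) * β)) / (2 * (x 0 : ℂ) ^ 2)
       (![![0, 0, 0], ![0, (ℓ : ℂ) ^ 2 * α, h], ![0, h, (ℓ : ℂ) ^ 2 * β]] :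
          Fin 3 → Fin 3 → ℂ) μ ν) := by
  have ha := hasDerivAt_add_smul (L.1 (x 1)) (chiralVar ε.1 L.1 (x 1))
  have hb := hasDerivAt_add_smul (L.2 (x 2)) (chiralVar ε.2 L.2 (x 2))
  have ho := ((((((ha.const_mul ((ℓ : ℂ) ^ 4)).fun_mul hb).div_const ((x 0 : ℂ) ^ 2)).const_add
    ((x 0 : ℂ) ^ 2)).fun_neg).div_const 2).deriv
  have h0 : deriv (fun _ : ℝ => (0 : ℂ)) 0 = 0 := by simp
  fin_cases μ <;> fin_cases ν
  · exact deriv_const _ _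
  · exact h0
  · exact h0
  · exact h0
  · exact (ha.const_mul _).deriv
  · refine ho.trans ?_
    simp
    ring
  · exact h0
  · refine ho.trans ?_
    simp
    ring
  · exact (hb.const_mul _).deriv

/-! ### The Lie derivative of the metric and the adjusted bracket -/

theorem lieDerivTensor_banadosMetric {ε L : ChiralPair} (hε : Admissible ε) (hL : Admissible L)
    (hx : x ∈ patch ℓ L) (μ ν : Fin 3) :
    lieDerivTensor (chi ℓ ε L) (banadosMetric ℓ L) x μ ν =
      variation ε (fun L' => banadosMetric ℓ L' x μ ν) L := by
  have hr0 : (x 0 : ℂ) ≠ 0 := by exact_mod_cast hx.1.ne'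
  have hD := sub_ne_zero.2 hx.2
  rw [metricVar]
  simp only [lieDerivTensor, Fin.sum_univ_three, (hasGrad_banadosMetric hL hr0 _ _).pderiv_eq,
    (hasGrad_chi_r hε x).pderiv_eq, (hasGrad_chi_plus hε hL hD).pderiv_eq,
    (hasGrad_chi_minus hε hL hD).pderiv_eq]
  simp only [chi_zero, chi_one, chi_two]
  -- The denominator is an atom while fractions are cleared, so that each occurrence of it,
  -- in whatever order its factors stand, is recognised as nonzero.
  obtain ⟨E, hE⟩ : ∃ E, E = (x 0 : ℂ) ^ 4 - (ℓ : ℂ) ^ 4 * L.1 (x 1) * L.2 (x 2) := ⟨_, rfl⟩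
  simp only [← hE] at hD ⊢
  fin_cases μ <;> fin_cases ν <;>
    simp only [banadosMetricGrad, banadosMetric, chiralVar, Fin.zero_eta, Fin.mk_one,
      Fin.reduceFinMk, Matrix.cons_val, Pi.zero_apply, mul_zero, zero_mul, add_zero, zero_add] <;>
    field_simp <;> subst hE <;> ring

section ParamBracket

variable {u v : ℝ → ℂ}

theorem hasDerivAt_iteratedDeriv (hu : ContDiff ℝ ∞ u) (n : ℕ) (y : ℝ) :
    HasDerivAt (iteratedDeriv n u) (iteratedDeriv (n + 1) u y) y := by
  rw [iteratedDeriv_succ]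
  exact (hu.differentiable_iteratedDeriv n (by exact_mod_cast WithTop.coe_lt_top _) y).hasDerivAt

/-- The first-order terms `u' v'` cancel, so no more than second derivatives occur. -/
theorem deriv_wronskian (hu : ContDiff ℝ ∞ u) (hv : ContDiff ℝ ∞ v) :
    deriv (fun y => u y * deriv v y - deriv u y * v y) =
      fun y => u y * iteratedDeriv 2 v y - iteratedDeriv 2 u y * v y := by
  funext y
  have hu0 := hasDerivAt_iteratedDeriv hu 0 y
  have hu1 := hasDerivAt_iteratedDeriv hu 1 y
  have hv0 := hasDerivAt_iteratedDeriv hv 0 y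
  have hv1 := hasDerivAt_iteratedDeriv hv 1 y
  simp only [iteratedDeriv_zero, iteratedDeriv_one, zero_add] at hu0 hu1 hv0 hv1
  rw [((hu0.fun_mul hv1).fun_sub (hu1.fun_mul hv0)).deriv]
  ring

theorem iteratedDeriv_two_wronskian (hu : ContDiff ℝ ∞ u) (hv : ContDiff ℝ ∞ v) (y : ℝ) :
    iteratedDeriv 2 (fun y => u y * deriv v y - deriv u y * v y) y =
      deriv u y * iteratedDeriv 2 v y + u y * iteratedDeriv 3 v y
        - iteratedDeriv 3 u y * v y - iteratedDeriv 2 u y * deriv v y := by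
  have hu0 := hasDerivAt_iteratedDeriv hu 0 y
  have hu2 := hasDerivAt_iteratedDeriv hu 2 y
  have hv0 := hasDerivAt_iteratedDeriv hv 0 y
  have hv2 := hasDerivAt_iteratedDeriv hv 2 y
  simp only [iteratedDeriv_zero, iteratedDeriv_one, zero_add] at hu0 hu2 hv0 hv2
  rw [iteratedDeriv_succ, iteratedDeriv_one, deriv_wronskian hu hv,
    ((hu0.fun_mul hv2).fun_sub (hu2.fun_mul hv0)).deriv]
  ring

end ParamBracket

theorem adjustedBracket_eq_chi {ε₁ ε₂ L : ChiralPair} (h₁ : Admissible ε₁) (h₂ : Admissible ε₂)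
    (hL : Admissible L) (hx : x ∈ patch ℓ L) :
    adjustedBracket ℓ ε₁ ε₂ L x = chi ℓ (paramBracket ε₁ ε₂) L x := by
  have hD := sub_ne_zero.2 hx.2
  funext μ
  simp only [adjustedBracket, Pi.sub_apply, lieBracket, Fin.sum_univ_three]
  fin_cases μ <;>
  simp only [Fin.zero_eta, Fin.mk_one, Fin.reduceFinMk,
    (hasGrad_chi_r h₁ x).pderiv_eq, (hasGrad_chi_plus h₁ hL hD).pderiv_eq,
    (hasGrad_chi_minus h₁ hL hD).pderiv_eq,
    (hasGrad_chi_r h₂ x).pderiv_eq, (hasGrad_chi_plus h₂ hL hD).pderiv_eq,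
    (hasGrad_chi_minus h₂ hL hD).pderiv_eq] <;>
  simp only [chi_zero, chi_one, chi_two,
    chiVar_r, chiVar_plus _ _ _ hD, chiVar_minus _ _ _ hD, paramBracket,
    deriv_wronskian h₁.1.1 h₂.1.1, deriv_wronskian h₁.2.1 h₂.2.1,
    iteratedDeriv_two_wronskian h₁.1.1 h₂.1.1, iteratedDeriv_two_wronskian h₁.2.1 h₂.2.1,
    chiralVar, Matrix.cons_val]
  · field_simp
    ring
  · field_simp
    ring
  · field_simp
    ring

end

/-! ### Fourier modes -/

theorem hasDerivAt_expMode (n : ℤ) (y : ℝ) :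
    HasDerivAt (expMode n) (Complex.I * n * expMode n y) y := by
  have h := ((Complex.ofRealCLM.hasDerivAt (x := y)).const_mul (Complex.I * n)).cexp
  rw [mul_comm]
  exact h.congr_deriv (by simp [expMode])

theorem deriv_expMode (n : ℤ) : deriv (expMode n) = fun y => Complex.I * n * expMode n y :=
  funext fun y => (hasDerivAt_expMode n y).deriv

theorem iteratedDeriv_expMode (n : ℤ) (k : ℕ) :
    iteratedDeriv k (expMode n) = fun y => (Complex.I * n) ^ k * expMode n y := by
  induction k with
  | zero => simp
  | succ k ih =>
    funext y
    rw [iteratedDeriv_succ, ih, ((hasDerivAt_expMode n y).const_mul _).deriv]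
    ring

theorem contDiff_expMode (n : ℤ) : ContDiff ℝ ∞ (expMode n) := by
  unfold expMode
  exact (contDiff_const.mul Complex.ofRealCLM.contDiff).cexp

theorem continuous_expMode (n : ℤ) : Continuous (expMode n) := (contDiff_expMode n).continuous

theorem periodic_expMode (n : ℤ) : Function.Periodic (expMode n) (2 * Real.pi) := fun y => by
  have h : Complex.I * n * ((y + 2 * Real.pi : ℝ) : ℂ) =
      Complex.I * n * y + n * (2 * Real.pi * Complex.I) := by
    push_cast
    ring
  rw [expMode, expMode, h, Complex.exp_add, Complex.exp_int_mul_two_pi_mul_I, mul_one]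

theorem expMode_mul (m n : ℤ) (y : ℝ) : expMode m y * expMode n y = expMode (m + n) y := by
  rw [expMode, expMode, expMode, ← Complex.exp_add]
  push_cast
  ring_nf

theorem admissible_plusMode (n : ℤ) : Admissible (plusMode n) :=
  ⟨⟨contDiff_expMode n, periodic_expMode n⟩, contDiff_const, fun _ => rfl⟩

theorem admissible_minusMode (n : ℤ) : Admissible (minusMode n) :=
  ⟨⟨contDiff_const, fun _ => rfl⟩, contDiff_expMode n, periodic_expMode n⟩

theorem expMode_wronskian (m n : ℤ) (y : ℝ) :
    expMode m y * deriv (expMode n) y - deriv (expMode m) y * expMode n y =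
      Complex.I * (n - m) * expMode (m + n) y := by
  rw [deriv_expMode, deriv_expMode, ← expMode_mul]
  ring

theorem paramBracket_plusMode (m n : ℤ) :
    paramBracket (plusMode m) (plusMode n) = (Complex.I * (n - m)) • plusMode (m + n) := by
  refine Prod.ext (funext fun y => expMode_wronskian m n y) (funext fun y => ?_)
  simp [paramBracket, plusMode]

theorem paramBracket_minusMode (m n : ℤ) :
    paramBracket (minusMode m) (minusMode n) = (Complex.I * (n - m)) • minusMode (m + n) := by
  refine Prod.ext (funext fun y => ?_) (funext fun y => expMode_wronskian m n y)
  simp [paramBracket, minusMode]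

theorem paramBracket_plusMode_minusMode (m n : ℤ) :
    paramBracket (plusMode m) (minusMode n) = 0 := by
  refine Prod.ext (funext fun y => ?_) (funext fun y => ?_) <;>
    simp [paramBracket, plusMode, minusMode, show (0 : ℝ → ℂ) = fun _ => 0 from rfl]

theorem chi_smul (ℓ : ℝ) (c : ℂ) (ε L : ChiralPair) (x : Coord) :
    chi ℓ (c • ε) L x = c • chi ℓ ε L x := by
  have h1 : ∀ u : ℝ → ℂ, deriv (c • u) = c • deriv u := fun u =>
    funext fun y => deriv_const_smul_field c u
  funext μ
  fin_cases μ <;> simp [chi, iteratedDeriv_succ, h1] <;> ring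

/-! ### Charges and their brackets -/

theorem integral_comp_add_period {f : ℝ → ℂ} (hf : Function.Periodic f (2 * Real.pi)) (a : ℝ) :
    ∫ φ in (0 : ℝ)..(2 * Real.pi), f (a + φ) = ∫ y in (0 : ℝ)..(2 * Real.pi), f y := by
  have h := hf.intervalIntegral_add_eq a 0
  rw [intervalIntegral.integral_comp_add_left]
  simpa using h

theorem integral_comp_sub_period {f : ℝ → ℂ} (hf : Function.Periodic f (2 * Real.pi)) (a : ℝ) :
    ∫ φ in (0 : ℝ)..(2 * Real.pi), f (a - φ) = ∫ y in (0 : ℝ)..(2 * Real.pi), f y := by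
  have h := hf.intervalIntegral_add_eq (a - 2 * Real.pi) 0
  rw [intervalIntegral.integral_comp_sub_left]
  simpa using h

/-- The charge does not depend on the time `t`, and the two chiral sectors enter alike although
`x⁻` runs backwards along the circle. -/
theorem charge_eq {ε L : ChiralPair} (hε : Admissible ε)
    (h₁ : Continuous L.1) (h₁' : Function.Periodic L.1 (2 * Real.pi))
    (h₂ : Continuous L.2) (h₂' : Function.Periodic L.2 (2 * Real.pi)) (ℓ G t : ℝ) :
    charge ℓ G t ε L = ((ℓ / (8 * Real.pi * G) : ℝ) : ℂ) *
      ((∫ y in (0 : ℝ)..(2 * Real.pi), ε.1 y * L.1 y) +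
        ∫ y in (0 : ℝ)..(2 * Real.pi), ε.2 y * L.2 y) := by
  have c₁ := hε.1.1.continuous
  have c₂ := hε.2.1.continuous
  rw [charge, intervalIntegral.integral_add
    (Continuous.intervalIntegrable (by fun_prop) _ _)
    (Continuous.intervalIntegrable (by fun_prop) _ _)]
  congr 2
  · exact integral_comp_add_period (hε.1.2.mul h₁') _
  · exact integral_comp_sub_period (hε.2.2.mul h₂') _

theorem periodic_deriv {u : ℝ → ℂ} {c : ℝ} (hu : Function.Periodic u c) :
    Function.Periodic (deriv u) c := fun y => by
  rw [← deriv_comp_add_const, hu.funext]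

theorem continuous_chiralVar {u v : ℝ → ℂ} (hu : ContDiff ℝ ∞ u) (hv : ContDiff ℝ ∞ v) :
    Continuous (chiralVar u v) := by
  have h1 := hv.continuous_deriv (by simp)
  have h2 := hu.continuous_deriv (by simp)
  have h3 := hu.continuous_iteratedDeriv 3 (WithTop.coe_le_coe.2 le_top)
  have h4 := hu.continuous
  have h5 := hv.continuous
  unfold chiralVar
  fun_prop

theorem periodic_chiralVar {u v : ℝ → ℂ} {c : ℝ} (hu : Function.Periodic u c)
    (hv : Function.Periodic v c) : Function.Periodic (chiralVar u v) c := fun y => by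
  have h1 := periodic_deriv hu
  have h3 := periodic_deriv (periodic_deriv h1)
  simp only [chiralVar, iteratedDeriv_succ, iteratedDeriv_zero, hu y, hv y, h1 y, h3 y,
    periodic_deriv hv y]

/-- The charge is linear in the fields, so its variation is the charge of the variation. -/
theorem chargeBracket_eq {ε₁ ε₂ L : ChiralPair} (h₁ : Admissible ε₁) (h₂ : Admissible ε₂)
    (hL : Admissible L) (ℓ G t : ℝ) :
    chargeBracket ℓ G t ε₁ ε₂ L = -(((ℓ / (8 * Real.pi * G) : ℝ) : ℂ) *
      ((∫ y in (0 : ℝ)..(2 * Real.pi), ε₂.1 y * chiralVar ε₁.1 L.1 y) +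
        ∫ y in (0 : ℝ)..(2 * Real.pi), ε₂.2 y * chiralVar ε₁.2 L.2 y)) := by
  have k₁ := continuous_chiralVar h₁.1.1 hL.1.1
  have k₂ := continuous_chiralVar h₁.2.1 hL.2.1
  have hlin : ∀ s : ℝ, charge ℓ G t ε₂ (L + s • fieldVar ε₁ L) =
      charge ℓ G t ε₂ L + s • charge ℓ G t ε₂ (fieldVar ε₁ L) := fun s => by
    have a₁ := h₂.1.1.continuous
    have a₂ := h₂.2.1.continuous
    have b₁ := hL.1.1.continuous
    have b₂ := hL.2.1.continuous
    simp only [charge, fieldVar, Complex.real_smul]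
    rw [mul_left_comm, ← mul_add, ← intervalIntegral.integral_const_mul (s : ℂ),
      ← intervalIntegral.integral_add (Continuous.intervalIntegrable (by fun_prop) _ _)
        (Continuous.intervalIntegrable (by fun_prop) _ _)]
    congr 2
    funext φ
    simp
    ring
  rw [chargeBracket, variation, funext hlin, (hasDerivAt_add_smul _ _).deriv,
    charge_eq h₂ k₁ (periodic_chiralVar h₁.1.2 hL.1.2) k₂ (periodic_chiralVar h₁.2.2 hL.2.2)]
  rfl

theorem integral_expMode (n : ℤ) :
    ∫ y in (0 : ℝ)..(2 * Real.pi), expMode n y = if n = 0 then 2 * (Real.pi : ℂ) else 0 := by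
  split_ifs with h
  · simp [expMode, h]
  · have hc : Complex.I * (n : ℂ) ≠ 0 := mul_ne_zero Complex.I_ne_zero (by exact_mod_cast h)
    have hp := periodic_expMode n 0
    simp only [expMode, zero_add] at hp
    simp only [expMode]
    rw [integral_exp_mul_complex hc, hp, sub_self, zero_div]

/-- The Virasoro cocycle. Integration by parts over the circle turns `L'` into `-i(m+n) L`; the
third derivative of the mode is the only term without `L`, and leaves the central term. -/
theorem integral_expMode_mul_chiralVar {u : ℝ → ℂ} (hu : ContDiff ℝ ∞ u)
    (hp : Function.Periodic u (2 * Real.pi)) (m n : ℤ) :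
    ∫ y in (0 : ℝ)..(2 * Real.pi), expMode n y * chiralVar (expMode m) u y =
      Complex.I * (m - n) * (∫ y in (0 : ℝ)..(2 * Real.pi), expMode (m + n) y * u y) +
        (if m + n = 0 then Complex.I * (m : ℂ) ^ 3 * Real.pi else 0) := by
  have hd : ∀ y, HasDerivAt u (deriv u y) y := fun y =>
    (hu.differentiable (by simp) y).hasDerivAt
  have hu' := hu.continuous_deriv (by simp)
  have huc := hu.continuous
  have hec := continuous_expMode (m + n)
  -- A total derivative over the circle.
  have hb : ∫ y in (0 : ℝ)..(2 * Real.pi), (expMode (m + n) y * deriv u y +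
      Complex.I * (m + n : ℤ) * expMode (m + n) y * u y) = 0 := by
    rw [intervalIntegral.integral_eq_sub_of_hasDerivAt
      (f := fun y => expMode (m + n) y * u y)
      (fun y _ => by
        exact ((hasDerivAt_expMode (m + n) y).fun_mul (hd y)).congr_deriv (add_comm _ _))
      (Continuous.intervalIntegrable (by fun_prop) _ _)]
    have h1 := periodic_expMode (m + n) 0
    have h2 := hp 0
    rw [zero_add] at h1 h2
    rw [h1, h2, sub_self]
  have hsplit : ∀ y, expMode n y * chiralVar (expMode m) u y =
      (expMode (m + n) y * deriv u y + Complex.I * (m + n : ℤ) * expMode (m + n) y * u y) +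
        (Complex.I * (m - n) * (expMode (m + n) y * u y) +
          Complex.I * (m : ℂ) ^ 3 / 2 * expMode (m + n) y) := fun y => by
    rw [chiralVar, deriv_expMode, iteratedDeriv_expMode, ← expMode_mul]
    push_cast
    linear_combination (-(m : ℂ) ^ 3 * Complex.I * expMode m y * expMode n y / 2) * Complex.I_sq
  simp only [hsplit]
  rw [intervalIntegral.integral_add (Continuous.intervalIntegrable (by fun_prop) _ _)
      (Continuous.intervalIntegrable (by fun_prop) _ _), hb,
    intervalIntegral.integral_add (Continuous.intervalIntegrable (by fun_prop) _ _)
      (Continuous.intervalIntegrable (by fun_prop) _ _),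
    intervalIntegral.integral_const_mul, intervalIntegral.integral_const_mul, integral_expMode]
  split_ifs <;> ring

theorem chiralVar_zero_left (u : ℝ → ℂ) : chiralVar 0 u = 0 := by
  funext y
  simp [chiralVar, show (0 : ℝ → ℂ) = fun _ => 0 from rfl]

section Virasoro

variable {ℓ G : ℝ} {L : ChiralPair}

/-- The normalisation `ℓ/8πG` of the charge converts the anomaly `m³ π` into `c m³/12`. -/
theorem charge_normalisation_mul_pi (ℓ : ℝ) {G : ℝ} (hG : G ≠ 0) :
    ((ℓ / (8 * Real.pi * G) : ℝ) : ℂ) * Real.pi = (centralCharge ℓ G : ℂ) / 12 := by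
  have hpi : (Real.pi : ℂ) ≠ 0 := by exact_mod_cast Real.pi_ne_zero
  have hG' : (G : ℂ) ≠ 0 := by exact_mod_cast hG
  rw [centralCharge]
  push_cast
  field_simp
  ring

theorem virasoro_plusMode (hG : G ≠ 0) (hL : Admissible L) (t : ℝ) (m n : ℤ) :
    Complex.I * chargeBracket ℓ G t (plusMode m) (plusMode n) L =
      ((m : ℂ) - n) * charge ℓ G t (plusMode (m + n)) L +
        (if m + n = 0 then (centralCharge ℓ G : ℂ) / 12 * (m : ℂ) ^ 3 else 0) := by
  rw [chargeBracket_eq (admissible_plusMode m) (admissible_plusMode n) hL,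
    charge_eq (admissible_plusMode _) hL.1.1.continuous hL.1.2 hL.2.1.continuous hL.2.2,
    ← charge_normalisation_mul_pi ℓ hG]
  simp only [plusMode, integral_expMode_mul_chiralVar hL.1.1 hL.1.2, Pi.zero_apply, zero_mul,
    intervalIntegral.integral_zero, add_zero]
  generalize (∫ y in (0 : ℝ)..(2 * Real.pi), expMode (m + n) y * L.1 y) = J
  generalize (((ℓ / (8 * Real.pi * G) : ℝ)) : ℂ) = k
  split_ifs
  · linear_combination (-k * ((m - n) * J + m ^ 3 * Real.pi)) * Complex.I_sq
  · linear_combination (-k * ((m - n) * J)) * Complex.I_sq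

theorem virasoro_minusMode (hG : G ≠ 0) (hL : Admissible L) (t : ℝ) (m n : ℤ) :
    Complex.I * chargeBracket ℓ G t (minusMode m) (minusMode n) L =
      ((m : ℂ) - n) * charge ℓ G t (minusMode (m + n)) L +
        (if m + n = 0 then (centralCharge ℓ G : ℂ) / 12 * (m : ℂ) ^ 3 else 0) := by
  rw [chargeBracket_eq (admissible_minusMode m) (admissible_minusMode n) hL,
    charge_eq (admissible_minusMode _) hL.1.1.continuous hL.1.2 hL.2.1.continuous hL.2.2,
    ← charge_normalisation_mul_pi ℓ hG]
  simp only [minusMode, integral_expMode_mul_chiralVar hL.2.1 hL.2.2, Pi.zero_apply, zero_mul,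
    intervalIntegral.integral_zero, zero_add]
  generalize (∫ y in (0 : ℝ)..(2 * Real.pi), expMode (m + n) y * L.2 y) = J
  generalize (((ℓ / (8 * Real.pi * G) : ℝ)) : ℂ) = k
  split_ifs
  · linear_combination (-k * ((m - n) * J + m ^ 3 * Real.pi)) * Complex.I_sq
  · linear_combination (-k * ((m - n) * J)) * Complex.I_sq

theorem chargeBracket_minusMode_plusMode (hL : Admissible L) (t : ℝ) (m n : ℤ) :
    chargeBracket ℓ G t (minusMode m) (plusMode n) L = 0 := by
  rw [chargeBracket_eq (admissible_minusMode m) (admissible_plusMode n) hL]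
  simp [minusMode, plusMode, chiralVar_zero_left]

end Virasoro

end AdS3

end

theorem mainTheorem5 (ℓ G : ℝ) (hℓ : 0 < ℓ) (hG : 0 < G) :
    -- `δ_ε L` is the variation of the fields that the diffeomorphism along `χ(ε; L)` induces
    (∀ ε L : AdS3.ChiralPair, AdS3.Admissible ε → AdS3.Admissible L →
      ∀ x ∈ AdS3.patch ℓ L, ∀ μ ν : Fin 3,
        AdS3.lieDerivTensor (AdS3.chi ℓ ε L) (AdS3.banadosMetric ℓ L) x μ ν =
          AdS3.variation ε (fun L' => AdS3.banadosMetric ℓ L' x μ ν) L) ∧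
    -- closure under the adjusted bracket
    (∀ ε₁ ε₂ L : AdS3.ChiralPair, AdS3.Admissible ε₁ → AdS3.Admissible ε₂ → AdS3.Admissible L →
      ∀ x ∈ AdS3.patch ℓ L,
        AdS3.adjustedBracket ℓ ε₁ ε₂ L x = AdS3.chi ℓ (AdS3.paramBracket ε₁ ε₂) L x) ∧
    -- two commuting Witt algebras
    (∀ L : AdS3.ChiralPair, AdS3.Admissible L → ∀ x ∈ AdS3.patch ℓ L, ∀ m n : ℤ,
      Complex.I • AdS3.adjustedBracket ℓ (AdS3.plusMode m) (AdS3.plusMode n) L x =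
          ((m : ℂ) - n) • AdS3.chi ℓ (AdS3.plusMode (m + n)) L x ∧
      AdS3.adjustedBracket ℓ (AdS3.plusMode m) (AdS3.minusMode n) L x = 0 ∧
      Complex.I • AdS3.adjustedBracket ℓ (AdS3.minusMode m) (AdS3.minusMode n) L x =
          ((m : ℂ) - n) • AdS3.chi ℓ (AdS3.minusMode (m + n)) L x) ∧
    -- two commuting Virasoro algebras
    (∀ L : AdS3.ChiralPair, AdS3.Admissible L → ∀ t : ℝ, ∀ m n : ℤ,
      Complex.I * AdS3.chargeBracket ℓ G t (AdS3.plusMode m) (AdS3.plusMode n) L =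
          ((m : ℂ) - n) * AdS3.charge ℓ G t (AdS3.plusMode (m + n)) L +
            (if m + n = 0 then (AdS3.centralCharge ℓ G : ℂ) / 12 * (m : ℂ) ^ 3 else 0) ∧
      AdS3.chargeBracket ℓ G t (AdS3.minusMode m) (AdS3.plusMode n) L = 0 ∧
      Complex.I * AdS3.chargeBracket ℓ G t (AdS3.minusMode m) (AdS3.minusMode n) L =
          ((m : ℂ) - n) * AdS3.charge ℓ G t (AdS3.minusMode (m + n)) L +
            (if m + n = 0 then (AdS3.centralCharge ℓ G : ℂ) / 12 * (m : ℂ) ^ 3 else 0)) := by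
  have hI : ∀ m n : ℤ, Complex.I * (Complex.I * ((n : ℂ) - m)) = m - n := fun m n => by
    linear_combination ((n : ℂ) - m) * Complex.I_sq
  refine ⟨fun ε L hε hL x hx μ ν => AdS3.lieDerivTensor_banadosMetric hε hL hx μ ν,
    fun ε₁ ε₂ L h₁ h₂ hL x hx => AdS3.adjustedBracket_eq_chi h₁ h₂ hL hx,
    fun L hL x hx m n => ⟨?_, ?_, ?_⟩,
    fun L hL t m n => ⟨AdS3.virasoro_plusMode hG.ne' hL t m n,
      AdS3.chargeBracket_minusMode_plusMode hL t m n,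
      AdS3.virasoro_minusMode hG.ne' hL t m n⟩⟩
  · rw [AdS3.adjustedBracket_eq_chi (AdS3.admissible_plusMode m) (AdS3.admissible_plusMode n) hL
        hx,
      AdS3.paramBracket_plusMode, AdS3.chi_smul, smul_smul, hI]
  · rw [AdS3.adjustedBracket_eq_chi (AdS3.admissible_plusMode m) (AdS3.admissible_minusMode n) hL
        hx,
      AdS3.paramBracket_plusMode_minusMode, ← zero_smul ℂ (0 : AdS3.ChiralPair),
      AdS3.chi_smul, zero_smul]
  · rw [AdS3.adjustedBracket_eq_chi (AdS3.admissible_minusMode m) (AdS3.admissible_minusMode n) hL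
        hx,
      AdS3.paramBracket_minusMode, AdS3.chi_smul, smul_smul, hI]
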